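/- Let $q$ be a prime power. For $n \ge 0$ let $E(q,n)$ be the set of all linear subspaces of $\mathrm{GF}(q)^n$, equipped with the injection metric $$d_I(U,V) = \max\{\dim U, \dim V\} - \dim(U\cap V) = \tfrac12\bigl(\dim(U+V)-\dim(U\cap V)\bigr) + \tfrac12\,|\dim U-\dim V|.$$ The injection covering radius of a nonempty code $\mathcal{C} \subseteq E(q,n)$ is $\max_{U\in E(q,n)} \min_{V\in\mathcal{C}} d_I(U,V)$. Let $K_I(q,n,\rho)$ be the minimum cardinality of a nonempty code $\mathcal{C} \subseteq E(q,n)$ with injection covering radius at most $\rho$, and for real $\rho' \ge 0$ let $$k_I(\rho') = \liminf_{n\to\infty} \frac{\log_q K_I(q,n,\lfloor n\rho'\rfloor)}{\log_q |E(q,n)|}.$$ Then $k_I(\rho') = (1-2\rho')^2$ for $0 \le \rho' \le \tfrac12$, and $k_I(\rho') = 0$ for $\rho' \ge \tfrac12$. -/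

import Mathlib

open Filter Topology

noncomputable section

namespace SubspaceCodes

/-- The projective space `E(q,n)`: the set of all subspaces of `F ^ n`, where `F` is a field
with `q` elements. -/
abbrev ProjSpace (F : Type*) [Field F] (n : ℕ) : Type _ := Submodule F (Fin n → F)

/-- The subspace distance `dim (U + V) - dim (U ∩ V)`; the subtraction does not truncate. -/
def subspaceDist {F : Type*} [Field F] {n : ℕ} (U V : ProjSpace F n) : ℕ :=
  Module.finrank F ↥(U ⊔ V) - Module.finrank F ↥(U ⊓ V)

/-- The injection distance `max (dim U) (dim V) - dim (U ∩ V)`; the subtraction does not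
truncate. -/
def injectionDist {F : Type*} [Field F] {n : ℕ} (U V : ProjSpace F n) : ℕ :=
  max (Module.finrank F ↥U) (Module.finrank F ↥V) - Module.finrank F ↥(U ⊓ V)

/-- The injection distance is half the subspace distance plus half the difference of the
dimensions. -/
theorem injectionDist_eq {F : Type*} [Field F] {n : ℕ} (U V : ProjSpace F n) :
    (injectionDist U V : ℝ) = (1 / 2) * (subspaceDist U V : ℝ)
      + (1 / 2) * |(Module.finrank F ↥U : ℝ) - (Module.finrank F ↥V : ℝ)| := by
  have h := Submodule.finrank_sup_add_finrank_inf_eq U V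
  have h1 : Module.finrank F ↥(U ⊓ V) ≤ Module.finrank F ↥U :=
    Submodule.finrank_mono inf_le_left
  have h2 : Module.finrank F ↥(U ⊓ V) ≤ Module.finrank F ↥V :=
    Submodule.finrank_mono inf_le_right
  have h3 : Module.finrank F ↥(U ⊓ V) ≤ Module.finrank F ↥(U ⊔ V) :=
    Submodule.finrank_mono (inf_le_left.trans le_sup_left)
  have hr : (Module.finrank F ↥(U ⊔ V) : ℝ) + (Module.finrank F ↥(U ⊓ V) : ℝ)
      = (Module.finrank F ↥U : ℝ) + (Module.finrank F ↥V : ℝ) := by exact_mod_cast h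
  unfold injectionDist subspaceDist
  rw [Nat.cast_sub (h1.trans (le_max_left _ _)), Nat.cast_sub h3]
  push_cast
  rcases le_total (Module.finrank F ↥U : ℝ) (Module.finrank F ↥V : ℝ) with hle | hle
  · rw [max_eq_right hle, abs_of_nonpos (by linarith)]; linarith
  · rw [max_eq_left hle, abs_of_nonneg (by linarith)]; linarith

/-- The injection distance `d(U, C) = min_{V ∈ C} d(U, V)` from a subspace to a (nonempty)
code. -/
def injectionDistToCode {F : Type*} [Field F] {n : ℕ} (U : ProjSpace F n)
    (C : Set (ProjSpace F n)) : ℕ :=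
  sInf (injectionDist U '' C)

/-- The injection covering radius `max_U d(U, C)` of a (nonempty) code `C` in `E(q,n)`. The
maximum is over a finite set when `F` is finite. -/
def injectionCoveringRadius {F : Type*} [Field F] {n : ℕ} (C : Set (ProjSpace F n)) : ℕ :=
  ⨆ U : ProjSpace F n, injectionDistToCode U C

/-- `K_I(q,n,ρ)`: the minimum cardinality of a subspace code (a nonempty subset of `E(q,n)`)
that covers `E(q,n)` with injection radius `ρ`, that is, of injection covering radius at
most `ρ`. -/
def minCoveringCard (F : Type*) [Field F] (n ρ : ℕ) : ℕ :=
  sInf {m : ℕ | ∃ C : Set (ProjSpace F n),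
    C.Nonempty ∧ injectionCoveringRadius C ≤ ρ ∧ C.ncard = m}

/-- The minimum defining `K_I(q,n,ρ)` is over a nonempty set, hence attained. -/
theorem exists_minCoveringCard (F : Type*) [Field F] (n ρ : ℕ) :
    ∃ C : Set (ProjSpace F n), C.Nonempty ∧ injectionCoveringRadius C ≤ ρ ∧
      C.ncard = minCoveringCard F n ρ := by
  refine Nat.sInf_mem (s := {m : ℕ | ∃ C : Set (ProjSpace F n),
    C.Nonempty ∧ injectionCoveringRadius C ≤ ρ ∧ C.ncard = m})
    ⟨_, Set.univ, Set.univ_nonempty, ?_, rfl⟩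
  refine (ciSup_le fun U => ?_).trans (Nat.zero_le ρ)
  exact Nat.sInf_le ⟨U, Set.mem_univ U, by rw [injectionDist, inf_idem, max_self, Nat.sub_self]⟩

/-- The asymptotic rate
`k_I(ρ') = liminf_{n → ∞} log_q K_I(q, n, ⌊n ρ'⌋) / log_q |E(q,n)|`, with `q = |F|`. The
limit inferior is taken in the extended reals, where it always exists. -/
def injectionCoveringRate (F : Type*) [Field F] (ρ' : ℝ) : EReal :=
  liminf (fun n : ℕ =>
    ((Real.logb (Nat.card F) (minCoveringCard F n ⌊(n : ℝ) * ρ'⌋₊ : ℝ)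
      / Real.logb (Nat.card F) (Nat.card (ProjSpace F n) : ℝ) : ℝ) : EReal)) atTop

end SubspaceCodes

end

namespace SubspaceCodes

open Module

/-! Up to factors `q ^ O(n)`, invisible after division by `n ^ 2`, the number of `k`-dimensional
subspaces of `GF(q)^n` is `q ^ (k * (n - k))`; the middle dimension dominates, so `|E(q,n)|` is
about `q ^ (n² / 4)`. It remains to see that `K_I(q,n,ρ)` is about `q ^ ((n - 2ρ)² / 4)` for `2ρ ≤
n`.

Lower bound (`pow_le_ncard_mul`): a ball of radius `ρ` contains at most about `q ^ (ρ * (n - ρ))`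
subspaces of dimension `k = n / 2`, whatever the dimension of its centre, and `k * (n - k) - ρ * (n
- ρ)` is about `(n - 2ρ)² / 4`.

Upper bound (`minCoveringCard_le`): the interval between `A ≤ B`, with `dim A = codim B = ρ`, is the
subspace lattice of `B / A`, of dimension `n - 2ρ`, and `A + (B ∩ U)` is within `ρ` of any `U`. -/

theorem pow_le_pow_sub_pow_mul {q n i : ℕ} (hq : 2 ≤ q) (hi : i < n) :
    q ^ n ≤ (q ^ n - q ^ i) * q := by
  obtain ⟨d, rfl⟩ := Nat.exists_eq_add_of_lt hi
  have h : q ^ i ≤ q ^ (i + d) := Nat.pow_le_pow_right (by omega) (by omega)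
  rw [Nat.sub_mul]
  have h2 : q ^ i * q ≤ q ^ (i + d) * q := Nat.mul_le_mul_right _ h
  rw [pow_succ] at *
  have h3 : q ^ (i + d) * q * 2 ≤ q ^ (i + d) * q * q := Nat.mul_le_mul_left _ hq
  omega

/-- Each factor loses at most a factor `q` against `q ^ n`. This crude bound suffices, as the total
loss `q ^ k` is of lower order. -/
theorem pow_mul_le_prod_mul {q n k : ℕ} (hq : 2 ≤ q) (hk : k ≤ n) :
    q ^ (n * k) ≤ (∏ i : Fin k, (q ^ n - q ^ i.val)) * q ^ k := by
  calc q ^ (n * k) = ∏ _i : Fin k, q ^ n := by simp [pow_mul]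
    _ ≤ ∏ i : Fin k, ((q ^ n - q ^ i.val) * q) :=
        Finset.prod_le_prod' fun i _ => pow_le_pow_sub_pow_mul hq (i.2.trans_le hk)
    _ = _ := by rw [Finset.prod_mul_distrib]; simp

theorem prod_le_pow_mul (q n k : ℕ) : (∏ i : Fin k, (q ^ n - q ^ i.val)) ≤ q ^ (n * k) := by
  calc _ ≤ ∏ _i : Fin k, q ^ n := Finset.prod_le_prod' fun i _ => Nat.sub_le _ _
    _ = q ^ (n * k) := by simp [pow_mul]

/-! ### Counting subspaces up to `q ^ O(n)` -/

section Count

variable {F : Type*} [Field F] [Finite F]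

theorem two_le_card : 2 ≤ Nat.card F := Finite.one_lt_card

variable {M : Type*} [AddCommGroup M] [Module F M]

theorem natCard_linearIndependent [Finite M] {k : ℕ} (hk : k ≤ finrank F M) :
    Nat.card {s : Fin k → M // LinearIndependent F s}
      = ∏ i : Fin k, (Nat.card F ^ finrank F M - Nat.card F ^ i.val) := by
  have := Fintype.ofFinite F
  rw [card_linearIndependent hk, Nat.card_eq_fintype_card]

variable (F M) in
/-- The number of `k`-dimensional subspaces of `M`. -/
noncomputable def numSubspaces (k : ℕ) : ℕ := Nat.card {U : Submodule F M // finrank F U = k}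

/-- Double counting: an independent `k`-tuple amounts to its span together with an ordered basis of
that span. -/
theorem numSubspaces_mul_prod [Finite M] {k : ℕ} (hk : k ≤ finrank F M) :
    numSubspaces F M k * ∏ i : Fin k, (Nat.card F ^ k - Nat.card F ^ i.val)
      = ∏ i : Fin k, (Nat.card F ^ finrank F M - Nat.card F ^ i.val) := by
  have := Fintype.ofFinite {U : Submodule F M // finrank F U = k}
  let f : (Σ U : {U : Submodule F M // finrank F U = k},
      {s : Fin k → U.1 // LinearIndependent F s}) → {s : Fin k → M // LinearIndependent F s} :=
    fun p => ⟨fun i => (p.2.1 i : M), p.2.2.map' _ (Submodule.ker_subtype _)⟩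
  have hspan (p) : Submodule.span F (Set.range (f p).1) = p.1.1 := by
    have hle : Submodule.span F (Set.range (f p).1) ≤ p.1.1 := by
      rw [Submodule.span_le]
      rintro _ ⟨i, rfl⟩
      exact (p.2.1 i).2
    refine Submodule.eq_of_le_of_finrank_eq hle ?_
    rw [finrank_span_eq_card (f p).2, p.1.2, Fintype.card_fin]
  have hf : Function.Bijective f := by
    constructor
    · intro p p' h
      have hU : p.1 = p'.1 := Subtype.ext (by rw [← hspan p, h, hspan])
      obtain ⟨U, s⟩ := p
      obtain ⟨U', s'⟩ := p'
      obtain rfl : U = U' := hU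
      have hs : s = s' := Subtype.ext <| funext fun i =>
        Subtype.ext (congrFun (congrArg Subtype.val h) i)
      rw [hs]
    · rintro ⟨s, hs⟩
      refine ⟨⟨⟨Submodule.span F (Set.range s), by simp [finrank_span_eq_card hs]⟩,
        fun i => ⟨s i, Submodule.subset_span ⟨i, rfl⟩⟩, ?_⟩, rfl⟩
      exact LinearIndependent.of_comp (Submodule.subtype _) hs
  rw [← natCard_linearIndependent hk, ← Nat.card_eq_of_bijective f hf, Nat.card_sigma]
  have h (U : {U : Submodule F M // finrank F U = k}) :
      Nat.card {s : Fin k → U.1 // LinearIndependent F s}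
        = ∏ i : Fin k, (Nat.card F ^ k - Nat.card F ^ i.val) := by
    rw [natCard_linearIndependent U.2.ge, U.2]
  rw [Finset.sum_congr rfl fun U _ => h U]
  simp [numSubspaces, Nat.card_eq_fintype_card]

theorem numSubspaces_le [Finite M] {k d : ℕ} (hM : finrank F M = k + d) :
    numSubspaces F M k ≤ Nat.card F ^ (k * d + k) := by
  set q := Nat.card F with hq
  have hq2 : 2 ≤ q := two_le_card
  have h := numSubspaces_mul_prod (F := F) (M := M) (k := k) (by omega)
  have h1 := pow_mul_le_prod_mul hq2 (le_refl k)
  have h2 := prod_le_pow_mul q (k + d) k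
  rw [hM] at h
  refine Nat.le_of_mul_le_mul_right ?_ (pow_pos (show 0 < q by omega) (k * k))
  calc numSubspaces F M k * q ^ (k * k)
      ≤ numSubspaces F M k * ((∏ i : Fin k, (q ^ k - q ^ i.val)) * q ^ k) :=
        Nat.mul_le_mul_left _ h1
    _ = (∏ i : Fin k, (q ^ (k + d) - q ^ i.val)) * q ^ k := by rw [← mul_assoc, h]
    _ ≤ q ^ ((k + d) * k) * q ^ k := Nat.mul_le_mul_right _ h2
    _ = q ^ (k * d + k) * q ^ (k * k) := by rw [← pow_add, ← pow_add]; ring_nf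

theorem pow_le_numSubspaces_mul [Finite M] {k d : ℕ} (hM : finrank F M = k + d) :
    Nat.card F ^ (k * d) ≤ numSubspaces F M k * Nat.card F ^ k := by
  set q := Nat.card F with hq
  have hq2 : 2 ≤ q := two_le_card
  have h := numSubspaces_mul_prod (F := F) (M := M) (k := k) (by omega)
  have h1 := pow_mul_le_prod_mul hq2 (show k ≤ k + d by omega)
  have h2 := prod_le_pow_mul q k k
  rw [hM] at h
  refine Nat.le_of_mul_le_mul_right ?_ (pow_pos (show 0 < q by omega) (k * k))
  calc q ^ (k * d) * q ^ (k * k) = q ^ ((k + d) * k) := by rw [← pow_add]; ring_nf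
    _ ≤ (∏ i : Fin k, (q ^ (k + d) - q ^ i.val)) * q ^ k := h1
    _ = numSubspaces F M k * (∏ i : Fin k, (q ^ k - q ^ i.val)) * q ^ k := by rw [← h]
    _ ≤ numSubspaces F M k * q ^ (k * k) * q ^ k := by gcongr
    _ = numSubspaces F M k * q ^ k * q ^ (k * k) := by ring

theorem natCard_submodule_le [Finite M] :
    Nat.card (Submodule F M)
      ≤ Nat.card F ^ (finrank F M * finrank F M / 4 + 2 * finrank F M) := by
  set n := finrank F M with hn
  set q := Nat.card F with hq
  have hq2 : 2 ≤ q := two_le_card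
  let f : Submodule F M → Σ k : Fin (n + 1), {U : Submodule F M // finrank F U = k} :=
    fun U => ⟨⟨finrank F U, Nat.lt_succ_of_le (Submodule.finrank_le U)⟩, U, rfl⟩
  have hf : Function.Injective f := fun U V h => by
    simp only [f, Sigma.mk.injEq, Fin.mk.injEq] at h
    obtain ⟨h1, h2⟩ := h
    rwa [Subtype.heq_iff_coe_eq] at h2
    intro W; rw [h1]
  have h1 := Nat.card_le_card_of_injective f hf
  rw [Nat.card_sigma] at h1
  refine h1.trans ?_
  calc ∑ k : Fin (n + 1), Nat.card {U : Submodule F M // finrank F U = k}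
      ≤ ∑ _k : Fin (n + 1), q ^ (n * n / 4 + n) := by
        refine Finset.sum_le_sum fun k _ => ?_
        obtain ⟨d, hd⟩ := Nat.exists_eq_add_of_le (Nat.le_of_lt_succ k.2)
        refine (numSubspaces_le (F := F) (M := M) (hn.symm.trans hd)).trans ?_
        refine Nat.pow_le_pow_right (by omega) ?_
        -- AM-GM for `k + d = n`.
        have : (k : ℕ) * d ≤ n * n / 4 := by
          rw [Nat.le_div_iff_mul_le (by norm_num)]
          have h3 : n * n = ((k : ℕ) + d) * (k + d) := congrArg (fun x => x * x) hd
          nlinarith [four_mul_le_pow_two_add (k : ℕ) d]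
        omega
    _ = (n + 1) * q ^ (n * n / 4 + n) := by simp
    _ ≤ q ^ n * q ^ (n * n / 4 + n) := by
        gcongr
        exact (Nat.lt_pow_self (by omega : 1 < q))
    _ = _ := by rw [← pow_add]; ring_nf

theorem pow_le_natCard_submodule_mul [Finite M] {k d : ℕ} (hM : finrank F M = k + d) :
    Nat.card F ^ (k * d) ≤ Nat.card (Submodule F M) * Nat.card F ^ k :=
  (pow_le_numSubspaces_mul hM).trans
    (Nat.mul_le_mul_right _ (Nat.card_le_card_of_injective _ Subtype.val_injective))

omit [Finite F] in
theorem exists_submodule_le_finrank_eq [Finite M] (V : Submodule F M) {w : ℕ}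
    (hw : w ≤ finrank F V) : ∃ W : Submodule F M, W ≤ V ∧ finrank F W = w := by
  obtain ⟨s, hs⟩ := exists_linearIndependent_of_le_finrank hw
  refine ⟨(Submodule.span F (Set.range s)).map V.subtype, Submodule.map_subtype_le _ _, ?_⟩
  rw [Submodule.finrank_map_subtype_eq, finrank_span_eq_card hs, Fintype.card_fin]

/-- Passing to the quotient by `W` is injective on the subspaces containing `W`. -/
theorem natCard_finrank_eq_and_ge_le [Finite M] (W : Submodule F M) {a d : ℕ}
    (hM : finrank F M = finrank F W + a + d) :
    Nat.card {U : Submodule F M // finrank F U = finrank F W + a ∧ W ≤ U}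
      ≤ Nat.card F ^ (a * d + a) := by
  have hfinQ : Finite (M ⧸ W) := Quotient.finite _
  have hQ : finrank F (M ⧸ W) = a + d := by
    have := W.finrank_quotient_add_finrank
    omega
  refine le_trans ?_ (numSubspaces_le hQ)
  have hfin (U : Submodule F M) (h : finrank F U = finrank F W + a ∧ W ≤ U) :
      finrank F (U.map W.mkQ) = a := by
    have h1 := (W.mkQ.domRestrict U).finrank_range_add_finrank_ker
    rw [LinearMap.range_domRestrict, LinearMap.ker_domRestrict, Submodule.ker_mkQ,
      (Submodule.comapSubtypeEquivOfLe h.2).finrank_eq] at h1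
    omega
  refine Nat.card_le_card_of_injective (fun U => ⟨U.1.map W.mkQ, hfin U.1 U.2⟩) ?_
  rintro ⟨U, hU⟩ ⟨V, hV⟩ h
  have h1 := congrArg (fun X => X.1.comap W.mkQ) h
  simp only [Submodule.comap_map_mkQ, sup_eq_right.2 hU.2, sup_eq_right.2 hV.2] at h1
  exact Subtype.ext h1

/-- Each such `U` contains some `w`-dimensional `W ≤ V`. Counting the pairs `(W, U)` may count `U`
repeatedly, which is harmless for an upper bound. -/
theorem natCard_finrank_eq_and_inf_ge_le [Finite M] (V : Submodule F M) {w a b d : ℕ}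
    (hV : finrank F V = w + b) (hM : finrank F M = w + a + d) :
    Nat.card {U : Submodule F M // finrank F U = w + a ∧ w ≤ finrank F ↥(U ⊓ V)}
      ≤ Nat.card F ^ (w * b + w + (a * d + a)) := by
  have := Fintype.ofFinite {W : Submodule F V // finrank F W = w}
  let T := Σ W : {W : Submodule F V // finrank F W = w},
    {U : Submodule F M // finrank F U = w + a ∧ W.1.map V.subtype ≤ U}
  have hex (U : {U : Submodule F M // finrank F U = w + a ∧ w ≤ finrank F ↥(U ⊓ V)}) :
      ∃ t : T, t.2.1 = U.1 := by
    obtain ⟨W, hW, hw⟩ := exists_submodule_le_finrank_eq _ U.2.2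
    have hmap : (W.comap V.subtype).map V.subtype = W := by
      rw [Submodule.map_comap_subtype, inf_eq_right.2 (hW.trans inf_le_right)]
    refine ⟨⟨⟨W.comap V.subtype, ?_⟩, ⟨U.1, U.2.1, ?_⟩⟩, rfl⟩
    · rw [← Submodule.finrank_map_subtype_eq, hmap, hw]
    · rw [hmap]
      exact hW.trans inf_le_left
  choose f hf using hex
  have hinj : Function.Injective f := fun U U' h => Subtype.ext (by rw [← hf U, h, hf U'])
  refine (Nat.card_le_card_of_injective f hinj).trans ?_
  rw [Nat.card_sigma]
  have hle (W : {W : Submodule F V // finrank F W = w}) :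
      Nat.card {U : Submodule F M // finrank F U = w + a ∧ W.1.map V.subtype ≤ U}
        ≤ Nat.card F ^ (a * d + a) := by
    have hW : finrank F (W.1.map V.subtype) = w := by
      rw [Submodule.finrank_map_subtype_eq, W.2]
    have := natCard_finrank_eq_and_ge_le (W.1.map V.subtype) (a := a) (d := d) (by rw [hW, hM])
    rwa [hW] at this
  refine (Finset.sum_le_sum fun W _ => hle W).trans ?_
  rw [Finset.sum_const, smul_eq_mul, Finset.card_univ, ← Nat.card_eq_fintype_card,
    pow_add _ (w * b + w)]
  exact Nat.mul_le_mul_right _ (numSubspaces_le hV)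

end Count

/-! ### Bounds on the size of covering codes -/

section CoveringCodes

variable {F : Type*} [Field F] [Finite F] {n : ℕ}

/-- Finiteness of `E(q,n)` and nonemptiness of `C` keep the supremum and infimum in `ℕ` from taking
their default value `0`. -/
theorem injectionCoveringRadius_le_iff {C : Set (ProjSpace F n)} (hC : C.Nonempty) {ρ : ℕ} :
    injectionCoveringRadius C ≤ ρ ↔ ∀ U, ∃ V ∈ C, injectionDist U V ≤ ρ := by
  constructor
  · intro h U
    have h1 : injectionDistToCode U C ≤ ρ :=
      (le_ciSup (f := fun U => injectionDistToCode U C) (Set.finite_range _).bddAbove U).trans h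
    obtain ⟨V, hV, hd⟩ := Nat.sInf_mem (hC.image (injectionDist U))
    exact ⟨V, hV, hd.le.trans h1⟩
  · intro h
    refine ciSup_le fun U => ?_
    obtain ⟨V, hV, hd⟩ := h U
    exact (Nat.sInf_le (Set.mem_image_of_mem _ hV)).trans hd

theorem natCard_finrank_eq_and_injectionDist_le (V : ProjSpace F n) {k ρ e : ℕ} (hρ : ρ ≤ k)
    (hn : n = ρ + k + e) :
    Nat.card {U : ProjSpace F n // finrank F U = k ∧ injectionDist U V ≤ ρ}
      ≤ Nat.card F ^ (ρ * (k + e) + k) := by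
  have hq : 0 < Nat.card F := Nat.card_pos
  -- A point `U₀` of the ball forces `dim V` to differ from `k` by at most `ρ`, which makes the
  -- parameters below natural numbers.
  rcases isEmpty_or_nonempty {U : ProjSpace F n // finrank F U = k ∧ injectionDist U V ≤ ρ}
    with hE | ⟨⟨U₀, hU₀, hd₀⟩⟩
  · simp
  have hM : finrank F (Fin n → F) = n := by simp
  have hU₀V : finrank F ↥(U₀ ⊓ V) ≤ k := hU₀ ▸ Submodule.finrank_mono inf_le_left
  have hVU₀ : finrank F ↥(U₀ ⊓ V) ≤ finrank F V := Submodule.finrank_mono inf_le_right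
  unfold injectionDist at hd₀
  rw [hU₀] at hd₀
  -- Take `w = max k (dim V) - ρ`, the least intersection dimension allowed in the ball. Then `a, b
  -- ≤ ρ`, with `b = ρ` if `k ≤ dim V` and `a = ρ` if `dim V ≤ k`.
  obtain ⟨w, a, b, hk, hV, hexp, hw⟩ : ∃ w a b : ℕ, k = w + a ∧ finrank F V = w + b ∧
      w * b + w + (a * (ρ + e) + a) ≤ ρ * (k + e) + k ∧ w ≤ max k (finrank F V) - ρ := by
    rcases le_total k (finrank F V) with h | h
    · obtain ⟨t, ht⟩ := Nat.exists_eq_add_of_le h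
      obtain ⟨a, ha⟩ := Nat.exists_eq_add_of_le (show t ≤ ρ by omega)
      obtain ⟨w, hw⟩ := Nat.exists_eq_add_of_le (show a ≤ k by omega)
      refine ⟨w, a, ρ, by omega, by omega, ?_, by omega⟩
      subst ha hw
      nlinarith [Nat.zero_le (t * (a + e))]
    · obtain ⟨w, hw⟩ := Nat.exists_eq_add_of_le hρ
      obtain ⟨b, hb⟩ := Nat.exists_eq_add_of_le (show w ≤ finrank F V by omega)
      refine ⟨w, ρ, b, by omega, by omega, ?_, by omega⟩
      have hbρ : b ≤ ρ := by omega
      subst hw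
      nlinarith [Nat.mul_le_mul_left w hbρ]
  refine le_trans ?_ ((natCard_finrank_eq_and_inf_ge_le V (a := a) (d := ρ + e) hV
    (by omega)).trans (Nat.pow_le_pow_right hq hexp))
  refine Nat.card_le_card_of_injective (fun U => ⟨U.1, U.2.1.trans hk, ?_⟩)
    fun U U' h => Subtype.ext (Subtype.mk.inj h)
  have hd := U.2.2
  unfold injectionDist at hd
  rw [U.2.1] at hd
  omega

/-- Sphere covering restricted to dimension `k`. In `2 * k`, one `k` comes from the count of
subspaces and one from the size of the ball. -/
theorem pow_le_ncard_mul {C : Set (ProjSpace F n)} (hC : C.Nonempty) {k ρ e : ℕ} (hρ : ρ ≤ k)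
    (hn : n = ρ + k + e) (hr : injectionCoveringRadius C ≤ ρ) :
    Nat.card F ^ (k * (ρ + e)) ≤ C.ncard * Nat.card F ^ (ρ * (k + e) + 2 * k) := by
  rw [injectionCoveringRadius_le_iff hC] at hr
  have := Fintype.ofFinite C
  have hM : finrank F (Fin n → F) = k + (ρ + e) := by simp; omega
  refine (pow_le_numSubspaces_mul hM).trans ?_
  rw [two_mul, ← add_assoc, pow_add _ _ k, ← mul_assoc]
  refine Nat.mul_le_mul_right _ ?_
  choose g hg hd using hr
  let f : {U : ProjSpace F n // finrank F U = k} →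
      Σ V : C, {U : ProjSpace F n // finrank F U = k ∧ injectionDist U V ≤ ρ} :=
    fun U => ⟨⟨g U, hg U⟩, ⟨U.1, U.2, hd U⟩⟩
  have hf (U) : (f U).2.1 = U.1 := rfl
  have hinj : Function.Injective f := fun U U' h => Subtype.ext (by rw [← hf U, h, hf U'])
  refine (Nat.card_le_card_of_injective f hinj).trans ?_
  rw [Nat.card_sigma]
  refine (Finset.sum_le_sum fun V _ =>
    natCard_finrank_eq_and_injectionDist_le V.1 hρ hn).trans ?_
  rw [Finset.sum_const, smul_eq_mul, Finset.card_univ, ← Nat.card_eq_fintype_card,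
    Nat.card_coe_set_eq]

theorem pow_le_minCoveringCard_mul {k ρ e : ℕ} (hρ : ρ ≤ k) (hn : n = ρ + k + e) :
    Nat.card F ^ (k * (ρ + e))
      ≤ minCoveringCard F n ρ * Nat.card F ^ (ρ * (k + e) + 2 * k) := by
  obtain ⟨C, hC, hr, hcard⟩ := exists_minCoveringCard F n ρ
  rw [← hcard]
  exact pow_le_ncard_mul hC hρ hn hr

theorem minCoveringCard_pos (ρ : ℕ) : 0 < minCoveringCard F n ρ := by
  obtain ⟨C, hC, hr, hcard⟩ := exists_minCoveringCard F n ρ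
  rw [← hcard]
  exact (Set.ncard_pos).2 hC

/-- For subspaces `A ≤ B` of dimension `r` and codimension `r`, the subspaces between `A` and `B`
form a code of covering radius at most `r`. -/
theorem minCoveringCard_le {r m ρ : ℕ} (hn : n = 2 * r + m) (hr : r ≤ ρ) :
    minCoveringCard F n ρ ≤ Nat.card F ^ (m * m / 4 + 2 * m) := by
  have hM : finrank F (Fin n → F) = n := by simp
  obtain ⟨B, -, hB⟩ := exists_submodule_le_finrank_eq (⊤ : ProjSpace F n) (w := r + m)
    (by rw [finrank_top]; omega)
  obtain ⟨A, -, hA⟩ := exists_submodule_le_finrank_eq (⊤ : Submodule F B) (w := r)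
    (by rw [finrank_top]; omega)
  have hfinQ : Finite (B ⧸ A) := Quotient.finite _
  have hQ : finrank F (B ⧸ A) = m := by
    have := A.finrank_quotient_add_finrank
    omega
  let f : Submodule F (B ⧸ A) → ProjSpace F n := fun W => (W.comap A.mkQ).map B.subtype
  have hC : (Set.range f).Nonempty := Set.range_nonempty f
  have hcard : (Set.range f).ncard ≤ Nat.card F ^ (m * m / 4 + 2 * m) := by
    have h1 := natCard_submodule_le (F := F) (M := B ⧸ A)
    rw [hQ] at h1
    refine le_trans ?_ h1
    rw [← Set.image_univ, ← Set.ncard_univ]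
    exact Set.ncard_image_le
  refine le_trans ?_ hcard
  unfold minCoveringCard
  refine Nat.sInf_le ⟨Set.range f, hC, ?_, rfl⟩
  rw [injectionCoveringRadius_le_iff hC]
  intro U
  -- The codeword `V = A + (B ∩ U)` meets `U` in at least `B ∩ U`, of dimension at least `dim U -
  -- r`, and `dim V ≤ r + dim (B ∩ U)`.
  refine ⟨_, ⟨(U.comap B.subtype).map A.mkQ, rfl⟩, ?_⟩
  have hf : f ((U.comap B.subtype).map A.mkQ) = (A ⊔ U.comap B.subtype).map B.subtype := by
    simp only [f, Submodule.comap_map_mkQ]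
  rw [hf]
  set V := (A ⊔ U.comap B.subtype).map B.subtype with hV
  have hUB : (U.comap B.subtype).map B.subtype = B ⊓ U := Submodule.map_comap_subtype _ _
  have h1 : finrank F ↥(B ⊓ U) ≤ finrank F ↥(U ⊓ V) := by
    refine Submodule.finrank_mono (le_inf inf_le_right ?_)
    rw [← hUB]
    exact Submodule.map_mono le_sup_right
  have h2 : finrank F V ≤ r + finrank F ↥(B ⊓ U) := by
    rw [hV, Submodule.finrank_map_subtype_eq, ← hUB, Submodule.finrank_map_subtype_eq, ← hA]
    exact Submodule.finrank_add_le_finrank_add_finrank _ _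
  have h3 := Submodule.finrank_sup_add_finrank_inf_eq B U
  have h4 := Submodule.finrank_le (B ⊔ U)
  unfold injectionDist
  omega

end CoveringCodes

/-! ### Logarithms and the limit -/

theorem tendsto_div_sq_of_abs_sub_le {a b : ℕ → ℝ} {β : ℝ}
    (h : ∀ n : ℕ, |a n - b n ^ 2 / 4| ≤ 2 * (n : ℝ) + 1)
    (hb : Tendsto (fun n => b n / n) atTop (𝓝 β)) :
    Tendsto (fun n : ℕ => a n / (n : ℝ) ^ 2) atTop (𝓝 (β ^ 2 / 4)) := by
  have h1 : Tendsto (fun n : ℕ => (2 : ℝ) * (1 / (n : ℝ)) + (1 / (n : ℝ)) * (1 / (n : ℝ))) atTop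
      (𝓝 (2 * 0 + 0 * 0)) :=
    (tendsto_one_div_atTop_nhds_zero_nat.const_mul 2).add
      (tendsto_one_div_atTop_nhds_zero_nat.mul tendsto_one_div_atTop_nhds_zero_nat)
  have h2 : Tendsto (fun n : ℕ => a n / (n : ℝ) ^ 2 - (b n / n) ^ 2 / 4) atTop (𝓝 0) := by
    refine squeeze_zero_norm' ?_ (by simpa using h1)
    filter_upwards [eventually_gt_atTop 0] with n hn
    have hn' : (0 : ℝ) < n := by exact_mod_cast hn
    have h3 : a n / (n : ℝ) ^ 2 - (b n / n) ^ 2 / 4 = (a n - b n ^ 2 / 4) / (n : ℝ) ^ 2 := by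
      field_simp
    rw [h3, Real.norm_eq_abs, abs_div, abs_of_pos (pow_pos hn' 2), div_le_iff₀ (pow_pos hn' 2)]
    refine (h n).trans (le_of_eq ?_)
    field_simp
  simpa using h2.add ((hb.pow 2).div_const 4)

variable (F : Type*) [Field F] [Finite F]

theorem one_lt_natCast_card : (1 : ℝ) < Nat.card F := by exact_mod_cast Finite.one_lt_card

variable {F}

theorem logb_card_le_of_le_pow {x e : ℕ} (hx : 0 < x) (h : x ≤ Nat.card F ^ e) :
    Real.logb (Nat.card F) x ≤ e := by
  rw [Real.logb_le_iff_le_rpow (one_lt_natCast_card F) (by exact_mod_cast hx), Real.rpow_natCast]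
  exact_mod_cast h

theorem sub_le_logb_card_of_pow_le_mul {x d e : ℕ} (h : Nat.card F ^ d ≤ x * Nat.card F ^ e) :
    (d : ℝ) - e ≤ Real.logb (Nat.card F) x := by
  have hq := one_lt_natCast_card F
  have hq0 : (0 : ℝ) < Nat.card F := by linarith
  have hx : 0 < x := by
    rcases Nat.eq_zero_or_pos x with rfl | hx
    · rw [zero_mul] at h
      exact absurd h (not_le.2 (pow_pos Nat.card_pos d))
    · exact hx
  rw [Real.le_logb_iff_rpow_le hq (by exact_mod_cast hx), Real.rpow_sub hq0,
    Real.rpow_natCast, Real.rpow_natCast, div_le_iff₀ (pow_pos hq0 e)]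
  exact_mod_cast h

theorem natCast_mul_div_four_le (m : ℕ) : ((m * m / 4 : ℕ) : ℝ) ≤ (m : ℝ) ^ 2 / 4 := by
  refine Nat.cast_div_le.trans (le_of_eq ?_)
  push_cast
  ring

theorem abs_logb_natCard_sub_le (n : ℕ) :
    |Real.logb (Nat.card F) (Nat.card (ProjSpace F n)) - (n : ℝ) ^ 2 / 4| ≤ 2 * (n : ℝ) + 1 := by
  have hM : finrank F (Fin n → F) = n := by simp
  have hup := logb_card_le_of_le_pow Nat.card_pos (natCard_submodule_le (F := F) (M := Fin n → F))
  rw [hM] at hup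
  have hlow := sub_le_logb_card_of_pow_le_mul (pow_le_natCard_submodule_mul (F := F)
    (M := Fin n → F) (k := n / 2) (d := n - n / 2) (by omega))
  obtain ⟨k, t, ht, hn⟩ : ∃ k t : ℕ, t ≤ 1 ∧ n = 2 * k + t := ⟨n / 2, n % 2, by omega, by omega⟩
  have h4 := natCast_mul_div_four_le n
  have hk : n / 2 = k := by omega
  have hk' : n - k = k + t := by omega
  rw [hk, hk'] at hlow
  push_cast at hup hlow
  have ht' : (t : ℝ) ≤ 1 := by exact_mod_cast ht
  have hn' : (n : ℝ) = 2 * k + t := by exact_mod_cast hn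
  have ht0 : (0 : ℝ) ≤ t := by positivity
  have hk0 : (0 : ℝ) ≤ k := by positivity
  rw [abs_le]
  constructor
  · rw [hn']
    nlinarith
  · linarith

theorem abs_logb_minCoveringCard_sub_le {n ρ : ℕ} (h : 2 * ρ ≤ n) :
    |Real.logb (Nat.card F) (minCoveringCard F n ρ) - ((n : ℝ) - 2 * ρ) ^ 2 / 4| ≤ 2 * (n : ℝ) + 1 := by
  obtain ⟨m, hm⟩ := Nat.exists_eq_add_of_le h
  have hup := logb_card_le_of_le_pow (minCoveringCard_pos (F := F) ρ)
    (minCoveringCard_le (F := F) hm le_rfl)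
  obtain ⟨k, t, ht, hn⟩ : ∃ k t : ℕ, t ≤ 1 ∧ n = 2 * k + t := ⟨n / 2, n % 2, by omega, by omega⟩
  obtain ⟨s, hs⟩ := Nat.exists_eq_add_of_le (show ρ ≤ k by omega)
  -- The exponents differ by `e * (k - ρ) - 2 * k = (s + t) * s - 2 * k`, while `(n - 2ρ)² / 4 = (s
  -- + t / 2)²`.
  have hlow := sub_le_logb_card_of_pow_le_mul (pow_le_minCoveringCard_mul (F := F)
    (k := k) (ρ := ρ) (e := s + t) (n := n) (by omega) (by omega))
  have h4 := natCast_mul_div_four_le m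
  have hm' : (m : ℝ) = n - 2 * ρ := by rw [hm]; push_cast; ring
  push_cast at hup hlow
  have hn' : (n : ℝ) = 2 * k + t := by exact_mod_cast hn
  have hs' : (k : ℝ) = ρ + s := by exact_mod_cast hs
  have ht' : (t : ℝ) ≤ 1 := by exact_mod_cast ht
  have ht0 : (0 : ℝ) ≤ t := by positivity
  have hk0 : (0 : ℝ) ≤ k := by positivity
  have hρ0 : (0 : ℝ) ≤ ρ := by positivity
  rw [abs_le]
  constructor
  · rw [hs'] at hlow hn'
    rw [hn']
    nlinarith
  · rw [← hm']
    linarith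

theorem abs_logb_minCoveringCard_le {n ρ : ℕ} (h : n / 2 ≤ ρ) :
    |Real.logb (Nat.card F) (minCoveringCard F n ρ)| ≤ 2 * (n : ℝ) + 1 := by
  -- With `r = n / 2` the quotient `B / A` has dimension `n % 2 ≤ 1`, so the code has bounded size.
  have hup := logb_card_le_of_le_pow (minCoveringCard_pos (F := F) ρ)
    (minCoveringCard_le (F := F) (show n = 2 * (n / 2) + n % 2 by omega) h)
  have h0 : 0 ≤ Real.logb (Nat.card F) (minCoveringCard F n ρ) :=
    Real.logb_nonneg (one_lt_natCast_card F) (by exact_mod_cast minCoveringCard_pos (F := F) ρ)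
  have hmod : n % 2 * (n % 2) / 4 + 2 * (n % 2) ≤ 2 * n + 1 := by
    rcases Nat.mod_two_eq_zero_or_one n with h | h <;> rw [h] <;> omega
  rw [abs_of_nonneg h0]
  exact hup.trans (by exact_mod_cast hmod)

/-- Divided by `n ^ 2`, the two logarithms tend to `β ^ 2 / 4` and `1 / 4`, so the lower limit is a
genuine limit. -/
theorem injectionCoveringRate_eq {ρ' β : ℝ} {b : ℕ → ℝ}
    (h : ∀ n : ℕ, |Real.logb (Nat.card F) (minCoveringCard F n ⌊(n : ℝ) * ρ'⌋₊) - b n ^ 2 / 4|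
      ≤ 2 * (n : ℝ) + 1)
    (hb : Tendsto (fun n => b n / n) atTop (𝓝 β)) :
    injectionCoveringRate F ρ' = ((β ^ 2 : ℝ) : EReal) := by
  have h1 := tendsto_div_sq_of_abs_sub_le h hb
  have h2 := tendsto_div_sq_of_abs_sub_le (b := fun n => (n : ℝ))
    (abs_logb_natCard_sub_le (F := F)) (β := 1) <| by
      refine tendsto_const_nhds.congr' ?_
      filter_upwards [eventually_gt_atTop 0] with n hn
      rw [div_self (by positivity)]
  have h3 := h1.div h2 (by norm_num)
  have hβ : β ^ 2 / 4 / (1 ^ 2 / 4) = β ^ 2 := by ring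
  rw [hβ] at h3
  refine Tendsto.liminf_eq ((continuous_coe_real_ereal.tendsto _).comp (h3.congr' ?_))
  filter_upwards [eventually_gt_atTop 0] with n hn
  exact div_div_div_cancel_right₀ (by positivity) _ _

end SubspaceCodes

theorem mainTheorem6 (F : Type*) [Field F] [Finite F] (ρ' : ℝ) :
    (0 ≤ ρ' → ρ' ≤ 1 / 2 →
      SubspaceCodes.injectionCoveringRate F ρ' = (((1 - 2 * ρ') ^ 2 : ℝ) : EReal)) ∧
    (1 / 2 ≤ ρ' → SubspaceCodes.injectionCoveringRate F ρ' = 0) := by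
  constructor
  · intro h0 h1
    refine SubspaceCodes.injectionCoveringRate_eq
      (b := fun n => (n : ℝ) - 2 * ⌊(n : ℝ) * ρ'⌋₊) (fun n => ?_) ?_
    · refine SubspaceCodes.abs_logb_minCoveringCard_sub_le ?_
      have h2 : (⌊(n : ℝ) * ρ'⌋₊ : ℝ) ≤ n * ρ' := Nat.floor_le (by positivity)
      have h3 : (2 * ⌊(n : ℝ) * ρ'⌋₊ : ℝ) ≤ n := by
        nlinarith [mul_le_mul_of_nonneg_left h1 (Nat.cast_nonneg (α := ℝ) n)]
      exact_mod_cast h3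
    · have h2 : Tendsto (fun n : ℕ => (⌊ρ' * n⌋₊ : ℝ) / n) atTop (𝓝 ρ') :=
        (tendsto_nat_floor_mul_div_atTop h0).comp tendsto_natCast_atTop_atTop
      refine ((h2.const_mul 2).const_sub 1).congr' ?_
      filter_upwards [eventually_gt_atTop 0] with n hn
      rw [mul_comm ρ']
      field_simp
  · intro h
    have := SubspaceCodes.injectionCoveringRate_eq (F := F) (ρ' := ρ') (b := fun _ => 0) (β := 0)
      (fun n => ?_) (by simp)
    · simpa using this
    · simp only [ne_eq, OfNat.ofNat_ne_zero, not_false_eq_true, zero_pow, zero_div, sub_zero]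
      refine SubspaceCodes.abs_logb_minCoveringCard_le (Nat.le_floor ?_)
      refine Nat.cast_div_le.trans ?_
      push_cast
      nlinarith [mul_le_mul_of_nonneg_left h (Nat.cast_nonneg (α := ℝ) n)]
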